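/- Let $d\in\mathbb{N}$ and let $\nu:\mathbb{R}^d\to[0,\infty)$ be a symmetric Lévy kernel, that is, $\nu(h)=\nu(-h)$ for all $h$ and $\int_{\mathbb{R}^d}(1\wedge|h|^2)\,\nu(h)\,dh<\infty$. Put $$\psi(\xi)=2\int_{\mathbb{R}^d}(1-\cos(\xi\cdot h))\,\nu(h)\,dh,\qquad \xi\in\mathbb{R}^d.$$ Let $\mathcal{P}_2(\mathbb{R}^d)$ be the set of Borel probability measures $u$ on $\mathbb{R}^d$ with $\int|x|^2\,du(x)<\infty$, let $$W(u_0,u_1)=\inf_{\gamma}\Big(\iint_{\mathbb{R}^d\times\mathbb{R}^d}|x-y|^2\,d\gamma(x,y)\Big)^{1/2}$$ be the $2$-Wasserstein distance, where $\gamma$ ranges over the probability measures on $\mathbb{R}^d\times\mathbb{R}^d$ with marginals $u_0$ and $u_1$, and let $\mathcal{F}:\mathcal{P}_2(\mathbb{R}^d)\to[0,\infty]$, $$\mathcal{F}(u)=\frac12\int_{\mathbb{R}^d}|\widehat{u}(\xi)|^2\,\psi(\xi)^{-1}\,d\xi,\qquad \widehat{u}(\xi)=(2\pi)^{-d/2}\int_{\mathbb{R}^d}e^{-i\xi\cdot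 x}\,du(x),$$ with $\psi(\xi)^{-1}=\infty$ where $\psi(\xi)=0$. Let $u_*\in\mathcal{P}_2(\mathbb{R}^d)$ and $\tau>0$. Then the functional $$u\mapsto \frac{1}{2\tau}W^2(u,u_*)+\mathcal{F}(u)$$ is lower semicontinuous on $\mathcal{P}_2(\mathbb{R}^d)$ with respect to narrow convergence. Moreover, if $\mathcal{F}$ is not identically $+\infty$ on $\mathcal{P}_2(\mathbb{R}^d)$, then this functional has a unique minimizer in $\mathcal{P}_2(\mathbb{R}^d)$. -/

import Mathlib

noncomputable section

open MeasureTheory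
open scoped ENNReal RealInnerProductSpace

namespace LevyEnergy

/-- `ℝ^d` with the Euclidean norm. -/
abbrev Rd (d : ℕ) : Type := EuclideanSpace ℝ (Fin d)

/-- `ν ≥ 0` is the Lebesgue density of a symmetric Lévy measure on `ℝ^d`. (Measurability of `ν`,
up to a null set, is part of the integrability of `(1 ∧ |h|²) ν(h)`.) -/
structure IsLevyKernel {d : ℕ} (ν : Rd d → ℝ) : Prop where
  nonneg : ∀ h, 0 ≤ ν h
  even : ∀ h, ν (-h) = ν h
  integrable : Integrable (fun h : Rd d => min 1 (‖h‖ ^ 2) * ν h)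

/-- The Fourier symbol `ψ(ξ) = 2 ∫ (1 - cos (ξ · h)) ν(h) dh` of the Lévy operator. -/
def symbol {d : ℕ} (ν : Rd d → ℝ) (ξ : Rd d) : ℝ :=
  2 * ∫ h : Rd d, (1 - Real.cos ⟪ξ, h⟫) * ν h

/-- The Fourier transform `û(ξ) = (2π)^(-d/2) ∫ exp(-i ξ · x) du(x)` of a probability measure. -/
def fourier {d : ℕ} (u : ProbabilityMeasure (Rd d)) (ξ : Rd d) : ℂ :=
  (((2 * Real.pi) ^ (-(d : ℝ) / 2) : ℝ) : ℂ) *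
    ∫ x : Rd d, Complex.exp (-(Complex.I * ((⟪ξ, x⟫ : ℝ) : ℂ))) ∂(u : Measure (Rd d))

/-- The energy `F(u) = (1/2) ∫ |û(ξ)|² ψ(ξ)⁻¹ dξ`, with values in `[0, ∞]`. The inverse is taken
in `[0, ∞]`, so that `ψ(ξ)⁻¹ = ∞` where `ψ(ξ) = 0`. -/
def energy {d : ℕ} (ν : Rd d → ℝ) (u : ProbabilityMeasure (Rd d)) : ℝ≥0∞ :=
  2⁻¹ * ∫⁻ ξ : Rd d, ‖fourier u ξ‖ₑ ^ 2 * (ENNReal.ofReal (symbol ν ξ))⁻¹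

/-- `P₂(ℝ^d)`: the Borel probability measures with finite second moment. As a subset of
`ProbabilityMeasure (Rd d)` it carries the topology of narrow convergence. -/
def P2 (d : ℕ) : Set (ProbabilityMeasure (Rd d)) :=
  {u | ∫⁻ x : Rd d, ‖x‖ₑ ^ 2 ∂(u : Measure (Rd d)) < ∞}

/-- The transport plans between `u₀` and `u₁`. -/
def plans {d : ℕ} (u₀ u₁ : ProbabilityMeasure (Rd d)) : Set (ProbabilityMeasure (Rd d × Rd d)) :=
  {γ | (γ : Measure (Rd d × Rd d)).map Prod.fst = u₀ ∧
    (γ : Measure (Rd d × Rd d)).map Prod.snd = u₁}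

/-- The `2`-Wasserstein distance. -/
def W {d : ℕ} (u₀ u₁ : ProbabilityMeasure (Rd d)) : ℝ≥0∞ :=
  (⨅ γ ∈ plans u₀ u₁,
    ∫⁻ p : Rd d × Rd d, ‖p.1 - p.2‖ₑ ^ 2 ∂(γ : Measure (Rd d × Rd d))) ^ (1 / 2 : ℝ)

/-- The effective domain `D(F) = {u ∈ P₂(ℝ^d) : F(u) < ∞}`. -/
def energyDomain {d : ℕ} (ν : Rd d → ℝ) : Set (ProbabilityMeasure (Rd d)) :=
  {u ∈ P2 d | energy ν u < ∞}

/-- The Moreau–Yosida penalization `u ↦ W²(u, u_*) / (2τ) + F(u)`. -/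
def moreauYosida {d : ℕ} (ν : Rd d → ℝ) (τ : ℝ) (uStar u : ProbabilityMeasure (Rd d)) : ℝ≥0∞ :=
  W u uStar ^ 2 / ENNReal.ofReal (2 * τ) + energy ν u

end LevyEnergy

end

/-! The marginal map `γ ↦ (γ₁, γ₂)` is proper for the narrow topology, by Prokhorov's theorem and
its converse. Hence the transport cost, an infimum of a lower semicontinuous function over its
fibres, is lower semicontinuous. The energy is `∫ |û|² dm` for a measure `m` which charges every
nonempty open set: up to a constant, `m = ψ⁻¹ dξ`, and `ψ` is finite everywhere. It is lower
semicontinuous by Fatou's lemma, and strictly convex by the parallelogram identity, since a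
probability measure is determined by its continuous characteristic function. The transport cost to
`u_*` is convex and controls second moments, so that sublevel sets of the sum are narrowly compact.
Existence and uniqueness of the minimizer follow.
-/

noncomputable section

open MeasureTheory Filter Topology
open scoped ENNReal NNReal RealInnerProductSpace BoundedContinuousFunction

namespace LevyEnergy

section LowerSemicontinuity

theorem lowerSemicontinuous_iInf_fiber {A B L : Type*} [TopologicalSpace A] [TopologicalSpace B]
    [CompleteLinearOrder L] [DenselyOrdered L] {π : A → B} (hπ : IsClosedMap π) {f : A → L}
    (hf : LowerSemicontinuous f) :
    LowerSemicontinuous fun b => ⨅ (a) (_ : π a = b), f a := by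
  intro b y hy
  obtain ⟨z, hyz, hz⟩ := exists_between hy
  have hopen : IsOpen (π '' (f ⁻¹' Set.Iic z))ᶜ := (hπ _ (hf.isClosed_preimage z)).isOpen_compl
  have hb : b ∈ (π '' (f ⁻¹' Set.Iic z))ᶜ := by
    rintro ⟨a, ha, hab⟩
    exact ((iInf₂_le a hab).trans ha).not_gt hz
  filter_upwards [hopen.mem_nhds hb] with b' hb'
  refine hyz.trans_le (le_iInf₂ fun a ha => ?_)
  by_contra! h
  exact hb' ⟨a, h.le, ha⟩

variable {X : Type*} [TopologicalSpace X] [MeasurableSpace X] [OpensMeasurableSpace X]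

theorem continuous_lintegral_min_natCast {f : X → ℝ≥0∞} (hf : Continuous f) (n : ℕ) :
    Continuous fun μ : ProbabilityMeasure X => ∫⁻ x, min (f x) n ∂(μ : Measure X) := by
  have htop (x : X) : min (f x) n ≠ ∞ := (min_lt_of_right_lt (ENNReal.natCast_lt_top n)).ne
  have hle (x : X) : (min (f x) n).toReal ≤ n :=
    ENNReal.toReal_le_of_le_ofReal n.cast_nonneg (by simp)
  let g : X →ᵇ ℝ≥0 := BoundedContinuousFunction.mkOfBound
    ⟨fun x => (min (f x) n).toNNReal, continuous_iff_continuousAt.2 fun x =>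
      (ENNReal.tendsto_toNNReal (htop x)).comp (hf.min continuous_const).continuousAt⟩ n
    fun x y => abs_sub_le_of_nonneg_of_le NNReal.zero_le_coe (hle x) NNReal.zero_le_coe (hle y)
  refine (ProbabilityMeasure.continuous_lintegral_boundedContinuousFunction g).congr fun μ => ?_
  exact lintegral_congr fun x => ENNReal.coe_toNNReal (htop x)

theorem lowerSemicontinuous_lintegral {f : X → ℝ≥0∞} (hf : Continuous f) :
    LowerSemicontinuous fun μ : ProbabilityMeasure X => ∫⁻ x, f x ∂(μ : Measure X) := by
  have hmono : Monotone fun (n : ℕ) x => min (f x) n := fun m n hmn x => by dsimp only; gcongr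
  have hsup (x : X) : ⨆ n : ℕ, min (f x) n = f x := by
    rw [← inf_iSup_eq, ENNReal.iSup_natCast, inf_top_eq]
  have htrunc (μ : ProbabilityMeasure X) :
      ∫⁻ x, f x ∂(μ : Measure X) = ⨆ n : ℕ, ∫⁻ x, min (f x) n ∂(μ : Measure X) := by
    rw [← lintegral_iSup (fun n => (hf.min continuous_const).measurable) hmono]
    simp only [hsup]
  simp only [htrunc]
  exact lowerSemicontinuous_iSup fun n =>
    (continuous_lintegral_min_natCast hf n).lowerSemicontinuous

end LowerSemicontinuity

section Average

variable {X Y : Type*} [MeasurableSpace X] [MeasurableSpace Y]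

/-- The midpoint `(u + v) / 2` of two probability measures, along which convexity is tested. -/
def average (u v : ProbabilityMeasure X) : ProbabilityMeasure X :=
  ⟨(2⁻¹ : ℝ≥0∞) • ((u : Measure X) + (v : Measure X)),
    ⟨by simp [ENNReal.inv_two_add_inv_two]⟩⟩

theorem coe_average (u v : ProbabilityMeasure X) :
    (average u v : Measure X) = (2⁻¹ : ℝ≥0∞) • ((u : Measure X) + (v : Measure X)) :=
  rfl

theorem average_self (u : ProbabilityMeasure X) : average u u = u := by
  apply Subtype.ext
  change (2⁻¹ : ℝ≥0∞) • ((u : Measure X) + (u : Measure X)) = u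
  rw [smul_add, ← add_smul, ENNReal.inv_two_add_inv_two, one_smul]

theorem lintegral_average (u v : ProbabilityMeasure X) (f : X → ℝ≥0∞) :
    ∫⁻ x, f x ∂(average u v : Measure X) =
      2⁻¹ * (∫⁻ x, f x ∂(u : Measure X) + ∫⁻ x, f x ∂(v : Measure X)) := by
  rw [coe_average, lintegral_smul_measure, lintegral_add_measure, smul_eq_mul]

theorem map_average (u v : ProbabilityMeasure X) {f : X → Y} (hf : Measurable f) :
    (average u v).map hf.aemeasurable = average (u.map hf.aemeasurable) (v.map hf.aemeasurable) :=
  Subtype.ext <| (Measure.map_smul ..).trans (congrArg _ (Measure.map_add _ _ hf))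

end Average

section TransportCost

variable {X Y : Type*} [MeasurableSpace X] [MeasurableSpace Y]

/-- The pair of marginals of a probability measure on a product. Its fibre over `(u, v)` is the set
of transport plans between `u` and `v`. -/
def marginals (γ : ProbabilityMeasure (X × Y)) : ProbabilityMeasure X × ProbabilityMeasure Y :=
  (γ.map measurable_fst.aemeasurable, γ.map measurable_snd.aemeasurable)

/-- The optimal transport cost between `u` and `v` for the cost function `c`. -/
def transportCost (c : X × Y → ℝ≥0∞) (u : ProbabilityMeasure X) (v : ProbabilityMeasure Y) :
    ℝ≥0∞ :=
  ⨅ (γ : ProbabilityMeasure (X × Y)) (_ : marginals γ = (u, v)), ∫⁻ p, c p ∂(γ : Measure (X × Y))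

theorem marginals_prod (u : ProbabilityMeasure X) (v : ProbabilityMeasure Y) :
    marginals (u.prod v) = (u, v) :=
  Prod.ext (ProbabilityMeasure.map_fst_prod u v) (ProbabilityMeasure.map_snd_prod u v)

theorem marginals_average (γ η : ProbabilityMeasure (X × Y)) :
    marginals (average γ η) =
      (average (marginals γ).1 (marginals η).1, average (marginals γ).2 (marginals η).2) :=
  Prod.ext (map_average γ η measurable_fst) (map_average γ η measurable_snd)

theorem lintegral_marginals_fst (γ : ProbabilityMeasure (X × Y)) {f : X → ℝ≥0∞}
    (hf : Measurable f) :
    ∫⁻ x, f x ∂((marginals γ).1 : Measure X) = ∫⁻ p, f p.1 ∂(γ : Measure (X × Y)) :=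
  lintegral_map hf measurable_fst

theorem lintegral_marginals_snd (γ : ProbabilityMeasure (X × Y)) {f : Y → ℝ≥0∞}
    (hf : Measurable f) :
    ∫⁻ y, f y ∂((marginals γ).2 : Measure Y) = ∫⁻ p, f p.2 ∂(γ : Measure (X × Y)) :=
  lintegral_map hf measurable_snd

theorem transportCost_average_le (c : X × Y → ℝ≥0∞) (u u' : ProbabilityMeasure X)
    (v v' : ProbabilityMeasure Y) :
    transportCost c (average u u') (average v v') ≤
      2⁻¹ * (transportCost c u v + transportCost c u' v') := by
  rw [← ENNReal.mul_le_iff_le_inv two_ne_zero ENNReal.ofNat_ne_top]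
  refine ENNReal.le_iInf₂_add_iInf₂ fun γ hγ η hη => ?_
  rw [ENNReal.mul_le_iff_le_inv two_ne_zero ENNReal.ofNat_ne_top, ← lintegral_average]
  exact iInf₂_le (average γ η) (by rw [marginals_average, hγ, hη])

variable [TopologicalSpace X] [BorelSpace X] [TopologicalSpace Y] [BorelSpace Y]

theorem continuous_marginals [SecondCountableTopology X] :
    Continuous (marginals : ProbabilityMeasure (X × Y) → _) :=
  (ProbabilityMeasure.continuous_map continuous_fst).prodMk
    (ProbabilityMeasure.continuous_map continuous_snd)

variable [PolishSpace X] [PolishSpace Y]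

theorem isTightMeasureSet_of_isCompact {K : Set (ProbabilityMeasure X)} (hK : IsCompact K) :
    IsTightMeasureSet {μ : Measure X | ∃ u ∈ K, (u : Measure X) = μ} := by
  let := TopologicalSpace.upgradeIsCompletelyMetrizable X
  exact isTightMeasureSet_of_isCompact_closure (hK.isClosed.closure_eq.symm ▸ hK)

theorem isCompact_preimage_marginals
    {K : Set (ProbabilityMeasure X × ProbabilityMeasure Y)} (hK : IsCompact K) :
    IsCompact (marginals ⁻¹' K) := by
  rw [← (hK.isClosed.preimage continuous_marginals).closure_eq]
  refine isCompact_closure_of_isTightMeasureSet (.prodMk ?_ ?_)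
  · refine (isTightMeasureSet_of_isCompact (hK.image continuous_fst)).subset ?_
    rintro _ ⟨_, ⟨γ, hγ, rfl⟩, rfl⟩
    exact ⟨_, ⟨_, hγ, rfl⟩, rfl⟩
  · refine (isTightMeasureSet_of_isCompact (hK.image continuous_snd)).subset ?_
    rintro _ ⟨_, ⟨γ, hγ, rfl⟩, rfl⟩
    exact ⟨_, ⟨_, hγ, rfl⟩, rfl⟩

theorem isProperMap_marginals : IsProperMap (marginals : ProbabilityMeasure (X × Y) → _) :=
  isProperMap_iff_isCompact_preimage.2
    ⟨continuous_marginals, fun _ hK => isCompact_preimage_marginals hK⟩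

theorem lowerSemicontinuous_transportCost {c : X × Y → ℝ≥0∞} (hc : Continuous c) :
    LowerSemicontinuous fun p : ProbabilityMeasure X × ProbabilityMeasure Y =>
      transportCost c p.1 p.2 :=
  lowerSemicontinuous_iInf_fiber isProperMap_marginals.isClosedMap
    (lowerSemicontinuous_lintegral hc)

end TransportCost

section SecondMoment

theorem enorm_sub_sq_le {F : Type*} [SeminormedAddCommGroup F] (x y : F) :
    ‖x - y‖ₑ ^ 2 ≤ 2 * (‖x‖ₑ ^ 2 + ‖y‖ₑ ^ 2) := by
  simp only [enorm_eq_nnnorm]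
  exact_mod_cast (pow_le_pow_left' (nnnorm_sub_le x y) 2).trans add_sq_le

variable {E : Type*} [NormedAddCommGroup E] [MeasurableSpace E]

/-- The second moment `∫ |x|² dμ`. -/
def secondMoment (μ : Measure E) : ℝ≥0∞ :=
  ∫⁻ x, ‖x‖ₑ ^ 2 ∂μ

variable (E) in
/-- The set `P₂(E)` of probability measures with finite second moment. -/
def finiteSecondMoment : Set (ProbabilityMeasure E) :=
  {u | secondMoment (u : Measure E) < ∞}

/-- The squared 2-Wasserstein distance. -/
def wassersteinSq (u v : ProbabilityMeasure E) : ℝ≥0∞ :=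
  transportCost (fun p => ‖p.1 - p.2‖ₑ ^ 2) u v

theorem average_mem_finiteSecondMoment {u v : ProbabilityMeasure E}
    (hu : u ∈ finiteSecondMoment E) (hv : v ∈ finiteSecondMoment E) :
    average u v ∈ finiteSecondMoment E :=
  (lintegral_average u v _).trans_lt
    (ENNReal.mul_lt_top (by simp) (ENNReal.add_lt_top.2 ⟨hu, hv⟩))

variable [BorelSpace E]

theorem measure_norm_gt_le_secondMoment (μ : Measure E) {r : ℝ} (hr : 0 < r) :
    μ {x | r < ‖x‖} ≤ secondMoment μ / ENNReal.ofReal r ^ 2 :=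
  calc μ {x | r < ‖x‖} ≤ μ {x | ENNReal.ofReal r ^ 2 ≤ ‖x‖ₑ ^ 2} := by
        refine measure_mono fun x (hx : r < ‖x‖) => ?_
        simp only [Set.mem_ofPred_eq, ← ofReal_norm]
        gcongr
    _ ≤ secondMoment μ / ENNReal.ofReal r ^ 2 :=
        meas_ge_le_lintegral_div (by fun_prop) (by simpa using hr) (by finiteness)

theorem isCompact_secondMoment_le [ProperSpace E] {C : ℝ≥0∞} (hC : C ≠ ∞) :
    IsCompact {u : ProbabilityMeasure E | secondMoment (u : Measure E) ≤ C} := by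
  have hclosed : IsClosed {u : ProbabilityMeasure E | secondMoment (u : Measure E) ≤ C} :=
    (lowerSemicontinuous_lintegral (by fun_prop)).isClosed_preimage C
  have hlim : Tendsto (fun r : ℝ => C / ENNReal.ofReal r ^ 2) atTop (𝓝 0) := by
    simpa using ENNReal.Tendsto.const_div
      (ENNReal.Tendsto.pow (n := 2) ENNReal.tendsto_ofReal_atTop) (Or.inr hC)
  rw [← hclosed.closure_eq]
  apply isCompact_closure_of_isTightMeasureSet
  apply isTightMeasureSet_of_tendsto_measure_norm_gt
  refine tendsto_of_tendsto_of_tendsto_of_le_of_le' tendsto_const_nhds hlim (by simp) ?_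
  filter_upwards [eventually_gt_atTop 0] with r hr
  refine iSup₂_le ?_
  rintro _ ⟨u, hu : secondMoment _ ≤ C, rfl⟩
  exact (measure_norm_gt_le_secondMoment _ hr).trans (by gcongr)

variable [SecondCountableTopology E]

theorem wassersteinSq_lt_top {u v : ProbabilityMeasure E} (hu : u ∈ finiteSecondMoment E)
    (hv : v ∈ finiteSecondMoment E) : wassersteinSq u v < ∞ :=
  calc wassersteinSq u v
      ≤ ∫⁻ p, ‖p.1 - p.2‖ₑ ^ 2 ∂(u.prod v : Measure (E × E)) :=
        iInf₂_le (u.prod v) (marginals_prod u v)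
    _ ≤ ∫⁻ p, 2 * (‖p.1‖ₑ ^ 2 + ‖p.2‖ₑ ^ 2) ∂(u.prod v : Measure (E × E)) :=
        lintegral_mono fun p => enorm_sub_sq_le p.1 p.2
    _ = 2 * (secondMoment (u : Measure E) + secondMoment (v : Measure E)) := by
        rw [lintegral_const_mul _ (by fun_prop), lintegral_add_left (by fun_prop),
          ← lintegral_marginals_fst _ (f := fun x => ‖x‖ₑ ^ 2) (by fun_prop),
          ← lintegral_marginals_snd _ (f := fun x => ‖x‖ₑ ^ 2) (by fun_prop), marginals_prod]
        rfl
    _ < ∞ := ENNReal.mul_lt_top (by simp) (ENNReal.add_lt_top.2 ⟨hu, hv⟩)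

theorem secondMoment_le_wassersteinSq (u v : ProbabilityMeasure E) :
    secondMoment (u : Measure E) ≤ 2 * (wassersteinSq u v + secondMoment (v : Measure E)) := by
  simp only [wassersteinSq, transportCost, iInf_subtype']
  rw [ENNReal.iInf_add, ENNReal.mul_iInf_of_ne (by simp) (by simp)]
  refine le_iInf fun ⟨γ, hγ⟩ => ?_
  obtain ⟨rfl, rfl⟩ := Prod.ext_iff.1 hγ
  calc secondMoment ((marginals γ).1 : Measure E)
      = ∫⁻ p, ‖p.1‖ₑ ^ 2 ∂(γ : Measure (E × E)) := lintegral_marginals_fst γ (by fun_prop)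
    _ ≤ ∫⁻ p, 2 * (‖p.1 - p.2‖ₑ ^ 2 + ‖p.2‖ₑ ^ 2) ∂(γ : Measure (E × E)) :=
        lintegral_mono fun p => by simpa using enorm_sub_sq_le (p.1 - p.2) (-p.2)
    _ = 2 * (∫⁻ p, ‖p.1 - p.2‖ₑ ^ 2 ∂(γ : Measure (E × E)) +
          secondMoment ((marginals γ).2 : Measure E)) := by
        rw [lintegral_const_mul _ (by fun_prop), lintegral_add_left (by fun_prop), secondMoment,
          lintegral_marginals_snd γ (by fun_prop)]

end SecondMoment

section CharFunEnergy

variable {E : Type*} [NormedAddCommGroup E] [InnerProductSpace ℝ E] [MeasurableSpace E]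

/-- The energy `∫ |∫ exp(i ξ · x) du(x)|² dm(ξ)`. The weight `ψ⁻¹` of the Lévy energy and the
normalization of the Fourier transform are absorbed into the measure `m`. -/
def charFunEnergy (m : Measure E) (u : ProbabilityMeasure E) : ℝ≥0∞ :=
  ∫⁻ ξ, ‖charFun (u : Measure E) ξ‖ₑ ^ 2 ∂m

theorem enorm_parallelogram {F : Type*} [NormedAddCommGroup F] [InnerProductSpace ℝ F] (x y : F) :
    ‖x + y‖ₑ ^ 2 + ‖x - y‖ₑ ^ 2 = 2 * (‖x‖ₑ ^ 2 + ‖y‖ₑ ^ 2) := by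
  simp only [enorm_eq_nnnorm]
  exact_mod_cast (by simpa only [sq] using parallelogram_law_with_nnnorm ℝ x y)

variable [BorelSpace E]

theorem continuous_charFun_apply (ξ : E) :
    Continuous fun u : ProbabilityMeasure E => charFun (u : Measure E) ξ := by
  simp only [charFun_eq_integral_innerProbChar]
  exact continuous_iff_continuousAt.2 fun u =>
    (ProbabilityMeasure.tendsto_iff_forall_integral_rclike_tendsto ℂ).1 tendsto_id _

theorem charFun_average (u v : ProbabilityMeasure E) (ξ : E) :
    charFun (average u v : Measure E) ξ =
      2⁻¹ * (charFun (u : Measure E) ξ + charFun (v : Measure E) ξ) := by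
  have hint (w : ProbabilityMeasure E) :
      Integrable (BoundedContinuousFunction.innerProbChar ξ) (w : Measure E) :=
    BoundedContinuousFunction.integrable _ _
  simp only [charFun_eq_integral_innerProbChar, coe_average]
  rw [integral_smul_measure, integral_add_measure (hint u) (hint v)]
  simp [mul_add]

variable [SecondCountableTopology E]

theorem lowerSemicontinuous_charFunEnergy (m : Measure E) :
    LowerSemicontinuous (charFunEnergy m) := by
  rw [lowerSemicontinuous_iff_le_liminf]
  intro u
  calc charFunEnergy m u
      = ∫⁻ ξ, liminf (fun v : ProbabilityMeasure E => ‖charFun (v : Measure E) ξ‖ₑ ^ 2) (𝓝 u) ∂m :=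
        lintegral_congr fun ξ =>
          (ENNReal.Tendsto.pow ((continuous_charFun_apply ξ).enorm.tendsto u)).liminf_eq.symm
    _ ≤ liminf (charFunEnergy m) (𝓝 u) :=
        lintegral_liminf_le fun v => measurable_charFun.enorm.pow_const 2

theorem charFunEnergy_average_add (m : Measure E) (u v : ProbabilityMeasure E) :
    charFunEnergy m (average u v) +
        ∫⁻ ξ, ‖2⁻¹ * (charFun (u : Measure E) ξ - charFun (v : Measure E) ξ)‖ₑ ^ 2 ∂m =
      2⁻¹ * (charFunEnergy m u + charFunEnergy m v) := by
  simp only [charFunEnergy]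
  rw [← lintegral_add_left (by fun_prop), ← lintegral_add_left (by fun_prop),
    ← lintegral_const_mul _ (by fun_prop)]
  refine lintegral_congr fun ξ => ?_
  have hu : charFun (average u v : Measure E) ξ +
      2⁻¹ * (charFun (u : Measure E) ξ - charFun (v : Measure E) ξ) =
        charFun (u : Measure E) ξ := by
    rw [charFun_average]; ring
  have hv : charFun (average u v : Measure E) ξ -
      2⁻¹ * (charFun (u : Measure E) ξ - charFun (v : Measure E) ξ) =
        charFun (v : Measure E) ξ := by
    rw [charFun_average]; ring
  have hpar := enorm_parallelogram (charFun (average u v : Measure E) ξ)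
    (2⁻¹ * (charFun (u : Measure E) ξ - charFun (v : Measure E) ξ))
  rw [hu, hv] at hpar
  rw [hpar, ENNReal.inv_mul_cancel_left two_ne_zero ENNReal.ofNat_ne_top]

variable [CompleteSpace E]

theorem lintegral_charFun_sub_ne_zero (m : Measure E) [m.IsOpenPosMeasure]
    {u v : ProbabilityMeasure E} (huv : u ≠ v) :
    ∫⁻ ξ, ‖2⁻¹ * (charFun (u : Measure E) ξ - charFun (v : Measure E) ξ)‖ₑ ^ 2 ∂m ≠ 0 := by
  have hmeas : Measurable fun ξ =>
      ‖2⁻¹ * (charFun (u : Measure E) ξ - charFun (v : Measure E) ξ)‖ₑ ^ 2 := by fun_prop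
  rw [Ne, lintegral_eq_zero_iff hmeas]
  intro h
  refine huv (Subtype.ext (Measure.ext_of_charFun (μ := (u : Measure E))
    (ν := (v : Measure E)) ?_))
  refine (Continuous.ae_eq_iff_eq m (by fun_prop) (by fun_prop)).1 ?_
  filter_upwards [h] with ξ hξ
  simpa [sub_eq_zero] using hξ

theorem charFunEnergy_average_lt (m : Measure E) [m.IsOpenPosMeasure]
    {u v : ProbabilityMeasure E} (huv : u ≠ v) (hu : charFunEnergy m u ≠ ∞)
    (hv : charFunEnergy m v ≠ ∞) :
    charFunEnergy m (average u v) < 2⁻¹ * (charFunEnergy m u + charFunEnergy m v) := by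
  have hfin : 2⁻¹ * (charFunEnergy m u + charFunEnergy m v) ≠ ∞ := by finiteness
  rw [← charFunEnergy_average_add] at hfin ⊢
  exact ENNReal.lt_add_right (ne_top_of_le_ne_top hfin le_self_add)
    (lintegral_charFun_sub_ne_zero m huv)

end CharFunEnergy

section PenalizedEnergy

variable {E : Type*} [NormedAddCommGroup E] [InnerProductSpace ℝ E] [MeasurableSpace E]

/-- The Moreau–Yosida penalization `u ↦ W²(u, v) / (2τ) + ∫ |û|² dm`. -/
def penalizedEnergy (m : Measure E) (τ : ℝ) (v u : ProbabilityMeasure E) : ℝ≥0∞ :=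
  wassersteinSq u v / ENNReal.ofReal (2 * τ) + charFunEnergy m u

variable [BorelSpace E] {m : Measure E} {τ : ℝ} {v : ProbabilityMeasure E}

theorem lowerSemicontinuous_penalizedEnergy [SecondCountableTopology E] [CompleteSpace E]
    (m : Measure E) (hτ : 0 < τ) (v : ProbabilityMeasure E) :
    LowerSemicontinuous (penalizedEnergy m τ v) := by
  have hτ' : ENNReal.ofReal (2 * τ) ≠ 0 := by simpa using hτ
  have hc : Continuous fun p : E × E => ‖p.1 - p.2‖ₑ ^ 2 :=
    (ENNReal.continuous_pow 2).comp (by fun_prop)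
  have hW : LowerSemicontinuous fun u => wassersteinSq u v :=
    (lowerSemicontinuous_transportCost hc).comp (continuous_id.prodMk continuous_const)
  exact (Continuous.comp_lowerSemicontinuous (ENNReal.continuous_div_const _ hτ') hW
    fun _ _ h => ENNReal.div_le_div_right h _).add (lowerSemicontinuous_charFunEnergy m)

theorem penalizedEnergy_lt_top [SecondCountableTopology E] {u : ProbabilityMeasure E} (hτ : 0 < τ)
    (hv : v ∈ finiteSecondMoment E) (hu : u ∈ finiteSecondMoment E) (hm : charFunEnergy m u < ∞) :
    penalizedEnergy m τ v u < ∞ :=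
  ENNReal.add_lt_top.2
    ⟨ENNReal.div_lt_top (wassersteinSq_lt_top hu hv).ne (by simpa using hτ), hm⟩

theorem secondMoment_le_penalizedEnergy [SecondCountableTopology E] (m : Measure E) (hτ : 0 < τ)
    (u v : ProbabilityMeasure E) :
    secondMoment (u : Measure E) ≤
      2 * (penalizedEnergy m τ v u * ENNReal.ofReal (2 * τ) + secondMoment (v : Measure E)) := by
  refine (secondMoment_le_wassersteinSq u v).trans ?_
  gcongr
  exact (ENNReal.div_le_iff (by simpa using hτ) ENNReal.ofReal_ne_top).1 le_self_add

theorem isCompact_penalizedEnergy_le [ProperSpace E] (m : Measure E) (hτ : 0 < τ)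
    (hv : v ∈ finiteSecondMoment E) {C : ℝ≥0∞} (hC : C ≠ ∞) :
    IsCompact {u | penalizedEnergy m τ v u ≤ C} := by
  have hv' : secondMoment (v : Measure E) ≠ ∞ := ne_of_lt hv
  refine (isCompact_secondMoment_le
    (C := 2 * (C * ENNReal.ofReal (2 * τ) + secondMoment (v : Measure E)))
    (by finiteness)).of_isClosed_subset
    ((lowerSemicontinuous_penalizedEnergy m hτ v).isClosed_preimage C) ?_
  intro u (hu : penalizedEnergy m τ v u ≤ C)
  exact (secondMoment_le_penalizedEnergy m hτ u v).trans (by gcongr)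

theorem exists_isMinOn_penalizedEnergy [ProperSpace E] (hτ : 0 < τ)
    (hv : v ∈ finiteSecondMoment E) {w : ProbabilityMeasure E} (hw : w ∈ finiteSecondMoment E)
    (hm : charFunEnergy m w < ∞) :
    ∃ u ∈ finiteSecondMoment E,
      IsMinOn (penalizedEnergy m τ v) (finiteSecondMoment E) u := by
  have hwfin := penalizedEnergy_lt_top hτ hv hw hm
  obtain ⟨u, huw, hu⟩ :=
    ((lowerSemicontinuous_penalizedEnergy m hτ v).lowerSemicontinuousOn _).exists_isMinOn
      ⟨w, le_refl (penalizedEnergy m τ v w)⟩ (isCompact_penalizedEnergy_le m hτ hv hwfin.ne)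
  have hufin : penalizedEnergy m τ v u < ∞ := huw.trans_lt hwfin
  refine ⟨u, (secondMoment_le_penalizedEnergy m hτ u v).trans_lt ?_, fun u' _ => ?_⟩
  · exact ENNReal.mul_lt_top (by simp)
      (ENNReal.add_lt_top.2 ⟨ENNReal.mul_lt_top hufin ENNReal.ofReal_lt_top, hv⟩)
  · rcases le_total (penalizedEnergy m τ v u') (penalizedEnergy m τ v w) with h | h
    · exact hu h
    · exact huw.trans h

variable [SecondCountableTopology E] [CompleteSpace E] [m.IsOpenPosMeasure]

theorem penalizedEnergy_average_lt {u u' : ProbabilityMeasure E} (h : u ≠ u')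
    (hu : penalizedEnergy m τ v u ≠ ∞) (hu' : penalizedEnergy m τ v u' ≠ ∞) :
    penalizedEnergy m τ v (average u u') <
      2⁻¹ * (penalizedEnergy m τ v u + penalizedEnergy m τ v u') := by
  rw [penalizedEnergy, ENNReal.add_ne_top] at hu hu'
  have hW : wassersteinSq (average u u') v / ENNReal.ofReal (2 * τ) ≤
      2⁻¹ * (wassersteinSq u v / ENNReal.ofReal (2 * τ) +
        wassersteinSq u' v / ENNReal.ofReal (2 * τ)) := by
    rw [← ENNReal.add_div, ← mul_div_assoc]
    gcongr
    simpa only [wassersteinSq, average_self] using transportCost_average_le _ u u' v v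
  have hWfin : wassersteinSq (average u u') v / ENNReal.ofReal (2 * τ) ≠ ∞ :=
    ne_top_of_le_ne_top (ENNReal.mul_ne_top (by simp) (ENNReal.add_ne_top.2 ⟨hu.1, hu'.1⟩)) hW
  calc penalizedEnergy m τ v (average u u')
      < 2⁻¹ * (wassersteinSq u v / ENNReal.ofReal (2 * τ) +
          wassersteinSq u' v / ENNReal.ofReal (2 * τ)) +
            2⁻¹ * (charFunEnergy m u + charFunEnergy m u') :=
        ENNReal.add_lt_add_of_le_of_lt hWfin hW (charFunEnergy_average_lt m h hu.2 hu'.2)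
    _ = 2⁻¹ * (penalizedEnergy m τ v u + penalizedEnergy m τ v u') := by
        simp only [penalizedEnergy]
        ring

theorem eq_of_isMinOn_penalizedEnergy {u u' : ProbabilityMeasure E}
    (hu : u ∈ finiteSecondMoment E) (hu' : u' ∈ finiteSecondMoment E)
    (hmin : IsMinOn (penalizedEnergy m τ v) (finiteSecondMoment E) u)
    (hmin' : IsMinOn (penalizedEnergy m τ v) (finiteSecondMoment E) u')
    (hfin : penalizedEnergy m τ v u ≠ ∞) : u = u' := by
  by_contra h
  have heq : penalizedEnergy m τ v u' = penalizedEnergy m τ v u :=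
    le_antisymm (hmin' hu) (hmin hu')
  have hlt := penalizedEnergy_average_lt h hfin (heq ▸ hfin)
  rw [heq, ← two_mul, ENNReal.inv_mul_cancel_left two_ne_zero ENNReal.ofNat_ne_top] at hlt
  exact (hmin (average_mem_finiteSecondMoment hu hu')).not_gt hlt

end PenalizedEnergy

section LevyKernel

variable {d : ℕ} {ν : Rd d → ℝ}

theorem aemeasurable_symbol (hν : IsLevyKernel ν) : AEMeasurable (symbol ν) := by
  have hfactor (ξ h : Rd d) : (1 - Real.cos ⟪ξ, h⟫) * ν h =
      (1 - Real.cos ⟪ξ, h⟫) / min 1 (‖h‖ ^ 2) * (min 1 (‖h‖ ^ 2) * ν h) := by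
    rcases eq_or_ne h 0 with rfl | h0
    · simp
    · have : min 1 (‖h‖ ^ 2) ≠ 0 := (lt_min one_pos (by positivity)).ne'
      field_simp
  have hcos : Measurable fun p : Rd d × Rd d =>
      (1 - Real.cos ⟪p.1, p.2⟫) / min 1 (‖p.2‖ ^ 2) := by fun_prop
  unfold symbol
  simp_rw [hfactor]
  exact ((hcos.aestronglyMeasurable.mul hν.integrable.1.comp_snd).integral_prod_right'.const_mul
    2).aemeasurable

theorem enorm_fourier (u : ProbabilityMeasure (Rd d)) (ξ : Rd d) :
    ‖fourier u ξ‖ₑ =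
      ‖((2 * Real.pi) ^ (-(d : ℝ) / 2) : ℝ)‖ₑ * ‖charFun (u : Measure (Rd d)) ξ‖ₑ := by
  have hconj : ∫ x : Rd d, Complex.exp (-(Complex.I * ((⟪ξ, x⟫ : ℝ) : ℂ))) ∂(u : Measure (Rd d)) =
      star (charFun (u : Measure (Rd d)) ξ) := by
    rw [← starRingEnd_apply, ← charFun_neg, charFun_apply]
    refine integral_congr_ae (.of_forall fun x => ?_)
    simp [real_inner_comm, mul_comm]
  rw [fourier, hconj, enorm_mul]
  simp [enorm_eq_nnnorm]

/-- The measure `(2π)⁻ᵈ ψ(ξ)⁻¹ dξ / 2`, for which the Lévy energy is a `charFunEnergy`. -/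
def levySpectralMeasure (ν : Rd d → ℝ) : Measure (Rd d) :=
  (2⁻¹ * ‖((2 * Real.pi) ^ (-(d : ℝ) / 2) : ℝ)‖ₑ ^ 2) •
    volume.withDensity fun ξ => (ENNReal.ofReal (symbol ν ξ))⁻¹

theorem charFunEnergy_levySpectralMeasure (hν : IsLevyKernel ν) :
    charFunEnergy (levySpectralMeasure ν) = energy ν := by
  ext u
  have hψ : AEMeasurable fun ξ => (ENNReal.ofReal (symbol ν ξ))⁻¹ :=
    (aemeasurable_symbol hν).ennreal_ofReal.inv
  simp only [charFunEnergy, levySpectralMeasure, energy, enorm_fourier, mul_pow, mul_assoc]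
  rw [lintegral_smul_measure, lintegral_withDensity_eq_lintegral_mul₀ hψ (by fun_prop),
    lintegral_const_mul' _ _ (by finiteness), smul_eq_mul, mul_assoc]
  simp only [Pi.mul_apply, mul_comm]

theorem isOpenPosMeasure_levySpectralMeasure (hν : IsLevyKernel ν) :
    (levySpectralMeasure ν).IsOpenPosMeasure := by
  have hψ : AEMeasurable fun ξ => (ENNReal.ofReal (symbol ν ξ))⁻¹ :=
    (aemeasurable_symbol hν).ennreal_ofReal.inv
  have hac : volume ≪ volume.withDensity fun ξ => (ENNReal.ofReal (symbol ν ξ))⁻¹ :=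
    withDensity_absolutelyContinuous' hψ (by simp)
  have := hac.isOpenPosMeasure
  refine Measure.isOpenPosMeasure_smul _ ?_
  have : (0 : ℝ) < (2 * Real.pi) ^ (-(d : ℝ) / 2) := by positivity
  simpa using this.ne'

theorem mem_plans_iff {u v : ProbabilityMeasure (Rd d)} {γ : ProbabilityMeasure (Rd d × Rd d)} :
    γ ∈ plans u v ↔ marginals γ = (u, v) :=
  ⟨fun h => Prod.ext (Subtype.ext h.1) (Subtype.ext h.2), fun h =>
    ⟨congrArg Subtype.val (congrArg Prod.fst h), congrArg Subtype.val (congrArg Prod.snd h)⟩⟩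

theorem W_sq (u v : ProbabilityMeasure (Rd d)) : W u v ^ 2 = wassersteinSq u v := by
  rw [W, ← ENNReal.rpow_natCast, ← ENNReal.rpow_mul]
  norm_num [wassersteinSq, transportCost, mem_plans_iff]

theorem penalizedEnergy_levySpectralMeasure (hν : IsLevyKernel ν) (τ : ℝ)
    (v : ProbabilityMeasure (Rd d)) :
    penalizedEnergy (levySpectralMeasure ν) τ v = moreauYosida ν τ v := by
  ext u
  rw [penalizedEnergy, moreauYosida, W_sq, charFunEnergy_levySpectralMeasure hν]

end LevyKernel

end LevyEnergy

end

theorem theorem3p1_general {E : Type*} [NormedAddCommGroup E] [InnerProductSpace ℝ E]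
    [FiniteDimensional ℝ E] [MeasurableSpace E] [BorelSpace E] (m : MeasureTheory.Measure E)
    [m.IsOpenPosMeasure] {uStar : MeasureTheory.ProbabilityMeasure E}
    (huStar : uStar ∈ LevyEnergy.finiteSecondMoment E) {τ : ℝ} (hτ : 0 < τ) :
    LowerSemicontinuous (LevyEnergy.penalizedEnergy m τ uStar) ∧
    ((∃ u ∈ LevyEnergy.finiteSecondMoment E, LevyEnergy.charFunEnergy m u < ⊤) →
      ∃! u : MeasureTheory.ProbabilityMeasure E,
        u ∈ LevyEnergy.finiteSecondMoment E ∧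
          IsMinOn (LevyEnergy.penalizedEnergy m τ uStar) (LevyEnergy.finiteSecondMoment E) u) := by
  have := FiniteDimensional.proper ℝ E
  refine ⟨LevyEnergy.lowerSemicontinuous_penalizedEnergy m hτ uStar, ?_⟩
  rintro ⟨w, hw, hwfin⟩
  obtain ⟨u, hu, hmin⟩ := LevyEnergy.exists_isMinOn_penalizedEnergy hτ huStar hw hwfin
  have hfin := (hmin hw).trans_lt (LevyEnergy.penalizedEnergy_lt_top hτ huStar hw hwfin)
  exact ⟨u, ⟨hu, hmin⟩, fun u' hu' =>
    (LevyEnergy.eq_of_isMinOn_penalizedEnergy hu hu'.1 hmin hu'.2 hfin.ne).symm⟩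

theorem theorem3p1 {d : ℕ} (ν : LevyEnergy.Rd d → ℝ) (hν : LevyEnergy.IsLevyKernel ν)
    (uStar : MeasureTheory.ProbabilityMeasure (LevyEnergy.Rd d))
    (huStar : uStar ∈ LevyEnergy.P2 d) (τ : ℝ) (hτ : 0 < τ) :
    LowerSemicontinuousOn (LevyEnergy.moreauYosida ν τ uStar) (LevyEnergy.P2 d) ∧
    ((LevyEnergy.energyDomain ν).Nonempty →
      ∃! u : MeasureTheory.ProbabilityMeasure (LevyEnergy.Rd d),
        u ∈ LevyEnergy.P2 d ∧
          IsMinOn (LevyEnergy.moreauYosida ν τ uStar) (LevyEnergy.P2 d) u) := by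
  have := LevyEnergy.isOpenPosMeasure_levySpectralMeasure hν
  rw [← LevyEnergy.penalizedEnergy_levySpectralMeasure hν, LevyEnergy.energyDomain,
    ← LevyEnergy.charFunEnergy_levySpectralMeasure hν]
  exact (theorem3p1_general (LevyEnergy.levySpectralMeasure ν) huStar hτ).imp_left
    fun h => h.lowerSemicontinuousOn _
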